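/- Call a real function $\phi$ on a set $U\subseteq\mathbb{R}$ \emph{locally regular} on $U$ if at least one of the following holds: (i) $\phi$ is bounded on some Lebesgue measurable subset of $U$ of positive Lebesgue measure; (ii) $\phi$ is continuous at some point of $U$; (iii) there is a Lebesgue measurable subset of $U$ of positive Lebesgue measure such that the restriction of $\phi$ to it is Lebesgue measurable. A function $d\colon\mathbb{R}\to\mathbb{R}$ is a \emph{derivation} if $d(x+y)=d(x)+d(y)$ and $d(xy)=d(x)y+xd(y)$ for all $x,y\in\mathbb{R}$. Let $n,m\in\mathbb{Z}\setminus\{0\}$, $n\neq m$, be such that $n=-m$ or $\operatorname{sign}(n)=\operatorname{sign}(m)$, and let $f,g\colon\mathbb{R}\to\mathbb{R}$ be additive functions. Define $\phi\colon\mathbb{R}\setminus\{0\}\to\mathbb{R}$ by $$\phi(x)=f(x^{n})-x^{n-m}g(x^{m})\qquad(x\in\mathbb{R}\setminus\{0\}),$$ and assume that $\phi$ is locally regular on $\mathbb{R}\setminus\{0\}$. Then the functions $F,G\colon\mathbb{R}\to\mathbb{R}$ defined by $F(x)=f(x)-f(1)x$ and $G(x)=g(x)-g(1)x$ are derivations,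 and $nF(x)=mG(x)$ for every $x\in\mathbb{R}$. -/

import Mathlib

/-- A real function `φ` with domain `U` is locally regular on `U` if it is bounded on a Lebesgue
measurable subset of `U` of positive measure, or continuous at a point of `U` (as a function on `U`),
or its restriction to some Lebesgue measurable subset of `U` of positive measure is Lebesgue
measurable. Lebesgue measurable sets are the null-measurable sets of `volume`. Only the values of
`φ` on `U` matter. -/
def LocallyRegularOn (φ : ℝ → ℝ) (U : Set ℝ) : Prop :=
  (∃ D ⊆ U, MeasureTheory.NullMeasurableSet D MeasureTheory.volume ∧
    0 < MeasureTheory.volume D ∧ ∃ C : ℝ, ∀ x ∈ D, |φ x| ≤ C) ∨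
  (∃ x ∈ U, ContinuousWithinAt φ U x) ∨
  (∃ D ⊆ U, MeasureTheory.NullMeasurableSet D MeasureTheory.volume ∧
    0 < MeasureTheory.volume D ∧
    ∀ B : Set ℝ, MeasurableSet B →
      MeasureTheory.NullMeasurableSet (D ∩ φ ⁻¹' B) MeasureTheory.volume)

/-! Local regularity gives a bound for `φ` on a compact `K ⊆ (0, ∞)` of positive measure; inversion
and exchanging `f` and `g` leave two cases. If `n = k + m` with `k, m ≥ 1`, rational homogeneity
makes `φ` along a rational line `x + t * h` a polynomial in `t` of degree at most `n`, with top
coefficient `φ h`. For small `h`, some `x` has all of `x, x + h, …, x + n * h` in `K`, so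
interpolation bounds `φ` near `0`, and homogeneity yields `|φ y| ≤ M * |y| ^ n`. After normalizing
to `f 1 = g 1 = 0`, the polynomial along `1 + t * x` vanishes to order `n` at `-1 / x` and also at
`0`, hence is zero (`pairLinePoly_eq_zero`). Its first two coefficients give `n * f x = m * g x` and
`f (x ^ 2) = 2 * x * f x`; polarization of the latter is the Leibniz rule. If `n = -m`, then `f x -
x ^ 2 * g x⁻¹` is bounded on such a set. A point, its reflection in `a` and their harmonic mean have
linearly related reciprocals, which eliminates `g` and leaves an instance of the first case with
exponents 2 and 1. -/

/-! ### Polynomial estimates -/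

-- Roots are split off one at a time: the bound survives division by `t - a` off `a`, and at `a` by
-- continuity.
open Polynomial in
theorem X_sub_C_pow_dvd_of_abs_eval_le {a M : ℝ} :
    ∀ {n : ℕ} {P : ℝ[X]}, (∀ t : ℝ, |P.eval t| ≤ M * |t - a| ^ n) → (X - C a) ^ n ∣ P := by
  intro n
  induction n with
  | zero => intro P _; simp
  | succ n ih =>
    intro P h
    have h0 : P.IsRoot a := by
      have := h a
      simpa using this
    obtain ⟨Q, rfl⟩ := dvd_iff_isRoot.mpr h0
    rw [pow_succ']
    refine mul_dvd_mul_left _ (ih ?_)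
    have hne : ∀ t ∈ ({a}ᶜ : Set ℝ), |Q.eval t| ≤ M * |t - a| ^ n := by
      intro t ht
      have hpos : 0 < |t - a| := abs_pos.mpr (sub_ne_zero.mpr ht)
      have := h t
      rw [eval_mul, abs_mul, eval_sub, eval_X, eval_C, pow_succ] at this
      refine le_of_mul_le_mul_left ?_ hpos
      linarith
    have hcl : IsClosed {t : ℝ | |Q.eval t| ≤ M * |t - a| ^ n} :=
      isClosed_le (by fun_prop) (by fun_prop)
    intro t
    have hd : t ∈ closure ({a}ᶜ : Set ℝ) := dense_compl_singleton a t
    exact hcl.closure_subset_iff.mpr hne hd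

open Polynomial in
theorem exists_abs_coeff_le_of_abs_eval_nat_le (n : ℕ) (B : ℝ) :
    ∃ M : ℝ, ∀ P : ℝ[X], P.natDegree ≤ n → (∀ j : ℕ, j ≤ n → |P.eval (j : ℝ)| ≤ B) →
      |P.coeff n| ≤ M := by
  have hinj : Set.InjOn (fun i : ℕ => (i : ℝ)) (Finset.range (n + 1)) :=
    fun i _ j _ h => Nat.cast_injective h
  refine ⟨∑ i ∈ Finset.range (n + 1),
    B * |(Lagrange.basis (Finset.range (n + 1)) (fun i : ℕ => (i : ℝ)) i).coeff n|, ?_⟩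
  intro P hP hB
  have hdeg : P.degree < (Finset.range (n + 1)).card := by
    rw [Finset.card_range]
    exact lt_of_le_of_lt (degree_le_of_natDegree_le hP) (by exact_mod_cast Nat.lt_succ_self n)
  rw [Lagrange.eq_interpolate hinj hdeg, Lagrange.interpolate_apply, finsetSum_coeff]
  refine (Finset.abs_sum_le_sum_abs _ _).trans (Finset.sum_le_sum fun i hi => ?_)
  rw [coeff_C_mul, abs_mul]
  exact mul_le_mul_of_nonneg_right (hB i (by simpa [Nat.lt_succ_iff] using hi)) (abs_nonneg _)

theorem AddMonoidHom.map_rat_mul (f : ℝ →+ ℝ) (q : ℚ) (x : ℝ) : f (q * x) = q * f x := by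
  simpa using map_ratCast_smul f ℝ ℝ q x

/-! ### Restriction to rational lines -/

/-- The polynomial in `t` that agrees with `f ((x + t * h) ^ n)` at rational `t`. -/
noncomputable def powLinePoly (f : ℝ →+ ℝ) (n : ℕ) (x h : ℝ) : Polynomial ℝ :=
  ∑ j ∈ Finset.range (n + 1),
    Polynomial.monomial j ((n.choose j : ℝ) * f (x ^ (n - j) * h ^ j))

theorem coeff_powLinePoly (f : ℝ →+ ℝ) (n : ℕ) (x h : ℝ) (j : ℕ) :
    (powLinePoly f n x h).coeff j = (n.choose j : ℝ) * f (x ^ (n - j) * h ^ j) := by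
  unfold powLinePoly
  rw [Polynomial.finsetSum_coeff]
  simp only [Polynomial.coeff_monomial, Finset.sum_ite_eq', Finset.mem_range]
  split_ifs with hj
  · rfl
  · rw [Nat.choose_eq_zero_of_lt (by omega)]; simp

theorem natDegree_powLinePoly_le (f : ℝ →+ ℝ) (n : ℕ) (x h : ℝ) :
    (powLinePoly f n x h).natDegree ≤ n := by
  rw [Polynomial.natDegree_le_iff_coeff_eq_zero]
  intro j hj
  rw [coeff_powLinePoly, Nat.choose_eq_zero_of_lt hj]; simp

theorem eval_powLinePoly (f : ℝ →+ ℝ) (n : ℕ) (x h : ℝ) (q : ℚ) :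
    (powLinePoly f n x h).eval (q : ℝ) = f ((x + q * h) ^ n) := by
  unfold powLinePoly
  rw [Polynomial.eval_finsetSum, add_comm x, add_pow, map_sum]
  refine Finset.sum_congr rfl fun j _ => ?_
  have : ((q : ℝ) * h) ^ j * x ^ (n - j) * (n.choose j : ℝ) =
      ((q ^ j * (n.choose j : ℚ) : ℚ) : ℝ) * (x ^ (n - j) * h ^ j) := by
    push_cast; ring
  rw [this, f.map_rat_mul, Polynomial.eval_monomial]
  push_cast; ring

/-- The polynomial in `t` that agrees with `f (y ^ (k + m)) - y ^ k * g (y ^ m)` at `y = x + t * h`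
for rational `t`. -/
noncomputable def pairLinePoly (f g : ℝ →+ ℝ) (k m : ℕ) (x h : ℝ) : Polynomial ℝ :=
  powLinePoly f (k + m) x h - powLinePoly (AddMonoidHom.id ℝ) k x h * powLinePoly g m x h

theorem eval_pairLinePoly (f g : ℝ →+ ℝ) (k m : ℕ) (x h : ℝ) (q : ℚ) :
    (pairLinePoly f g k m x h).eval (q : ℝ) =
      f ((x + q * h) ^ (k + m)) - (x + q * h) ^ k * g ((x + q * h) ^ m) := by
  simp [pairLinePoly, eval_powLinePoly]

theorem natDegree_pairLinePoly_le (f g : ℝ →+ ℝ) (k m : ℕ) (x h : ℝ) :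
    (pairLinePoly f g k m x h).natDegree ≤ k + m := by
  simpa [pairLinePoly] using
    Polynomial.natDegree_sub_le_of_le (natDegree_powLinePoly_le f (k + m) x h)
      (Polynomial.natDegree_mul_le_of_le (natDegree_powLinePoly_le (AddMonoidHom.id ℝ) k x h)
        (natDegree_powLinePoly_le g m x h))

theorem coeff_top_pairLinePoly (f g : ℝ →+ ℝ) (k m : ℕ) (x h : ℝ) :
    (pairLinePoly f g k m x h).coeff (k + m) = f (h ^ (k + m)) - h ^ k * g (h ^ m) := by
  rw [pairLinePoly, Polynomial.coeff_sub, Polynomial.coeff_mul_add_eq_of_natDegree_le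
    (natDegree_powLinePoly_le _ _ x h) (natDegree_powLinePoly_le g _ x h)]
  simp [coeff_powLinePoly]

theorem relations_of_pairLinePoly_eq_zero (f g : ℝ →+ ℝ) (hg : g 1 = 0) (k m : ℕ) (x : ℝ)
    (h : pairLinePoly f g k m 1 x = 0) :
    ((k + m : ℕ) : ℝ) * f x = m * g x ∧
      ((k + m : ℕ).choose 2 : ℝ) * f (x ^ 2) = (m.choose 2 : ℝ) * g (x ^ 2) + k * m * (x * g x) := by
  have h1 := congrArg (fun P => Polynomial.coeff P 1) h
  have h2 := congrArg (fun P => Polynomial.coeff P 2) h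
  simp only [pairLinePoly, Polynomial.coeff_sub, Polynomial.coeff_mul, Polynomial.coeff_zero,
    coeff_powLinePoly, Finset.Nat.antidiagonal_succ, Finset.Nat.antidiagonal_zero,
    Finset.sum_cons, Finset.map_cons, Finset.map_singleton,
    Finset.sum_singleton, Function.Embedding.prodMap, Function.Embedding.coeFn_mk, Prod.map,
    one_pow, one_mul, pow_zero, Nat.choose_zero_right, Nat.cast_one, Nat.choose_one_right,
    AddMonoidHom.id_apply, hg, Function.Embedding.refl_apply, pow_one] at h1 h2
  simp at h1 h2
  constructor
  · push_cast; linarith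
  · linarith

/-! ### Compact sets of positive measure under near-identity affine maps -/

/-- `φ` is bounded on a compact set of positive measure inside `(0, ∞)`. -/
def BoundedOnPosCompact (φ : ℝ → ℝ) : Prop :=
  ∃ K : Set ℝ, IsCompact K ∧ K ⊆ Set.Ioi 0 ∧ 0 < MeasureTheory.volume K ∧
    ∃ B : ℝ, ∀ x ∈ K, |φ x| ≤ B

-- An open `U ⊇ K` exceeding `K` by less than `ε` contains the image of `K`, so bad points land in
-- `U \ K`; pulling back by slope `a ≥ 1 / 2` at most doubles measure.
open MeasureTheory in
theorem IsCompact.exists_volume_affine_notMem_le {K : Set ℝ} (hK : IsCompact K)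
    {ε : ENNReal} (hε : ε ≠ 0) :
    ∃ δ > 0, ∀ a b : ℝ, 1 / 2 ≤ a → (∀ x ∈ K, |a * x + b - x| < δ) →
      volume {x | x ∈ K ∧ a * x + b ∉ K} ≤ 2 * ε := by
  obtain ⟨U, hKU, hU, hlt⟩ := hK.exists_isOpen_lt_add (μ := volume) hε
  obtain ⟨δ, hδ, hsub⟩ := hK.exists_thickening_subset_open hU hKU
  refine ⟨δ, hδ, fun a b ha hclose => ?_⟩
  have hUK : volume (U \ K) ≤ ε := by
    rw [measure_sdiff hKU hK.measurableSet.nullMeasurableSet hK.measure_ne_top]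
    exact tsub_le_iff_left.mpr hlt.le
  have hincl : {x | x ∈ K ∧ a * x + b ∉ K} ⊆ (a * ·) ⁻¹' ((· + b) ⁻¹' (U \ K)) := by
    rintro x ⟨hx, hx'⟩
    refine ⟨hsub (Metric.mem_thickening_iff.mpr ⟨x, hx, ?_⟩), hx'⟩
    rw [Real.dist_eq]; exact hclose x hx
  refine (measure_mono hincl).trans ?_
  rw [Real.volume_preimage_mul_left (by linarith), measure_preimage_add_right]
  refine mul_le_mul' ?_ hUK
  rw [abs_of_pos (by positivity), ← ENNReal.ofReal_ofNat]
  refine ENNReal.ofReal_le_ofReal ?_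
  rw [inv_le_comm₀ (by linarith) (by norm_num)]; linarith

open MeasureTheory in
theorem IsCompact.exists_volume_affine_mem_pos {K : Set ℝ} (hK : IsCompact K)
    (hpos : 0 < volume K) (N : ℕ) :
    ∃ δ > 0, ∀ a b : ℕ → ℝ, (∀ i < N, 1 / 2 ≤ a i ∧ ∀ x ∈ K, |a i * x + b i - x| < δ) →
      0 < volume {x | x ∈ K ∧ ∀ i < N, a i * x + b i ∈ K} := by
  obtain ⟨ε, hε, hlt⟩ := ENNReal.exists_nnreal_pos_mul_lt
    (a := (N : ENNReal) * 2) (b := volume K) (by finiteness) hpos.ne'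
  obtain ⟨δ, hδ, h⟩ := hK.exists_volume_affine_notMem_le (ε := ε) (by exact_mod_cast hε.ne')
  refine ⟨δ, hδ, fun a b hab => ?_⟩
  rw [pos_iff_ne_zero]
  intro h0
  have hcover : K ⊆ {x | x ∈ K ∧ ∀ i < N, a i * x + b i ∈ K} ∪
      ⋃ i ∈ Finset.range N, {x | x ∈ K ∧ a i * x + b i ∉ K} := by
    intro x hx
    by_cases hg : ∀ i < N, a i * x + b i ∈ K
    · exact Or.inl ⟨hx, hg⟩
    · push Not at hg
      obtain ⟨i, hi, hi'⟩ := hg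
      exact Or.inr (by simpa using ⟨hx, i, hi, hi'⟩)
  have hle := (measure_mono hcover).trans (measure_union_le (μ := volume) _ _)
  rw [h0, zero_add] at hle
  have hle2 := hle.trans (measure_biUnion_finset_le _ _)
  have hle3 := hle2.trans (Finset.sum_le_sum fun i hi =>
    h (a i) (b i) (hab i (Finset.mem_range.mp hi)).1 (hab i (Finset.mem_range.mp hi)).2)
  rw [Finset.sum_const, Finset.card_range, nsmul_eq_mul] at hle3
  refine absurd hlt (not_lt.mpr (hle3.trans (le_of_eq ?_)))
  ring

/-! ### Exponents of equal sign -/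

theorem exists_bound_near_zero {f g : ℝ →+ ℝ} {k m : ℕ}
    (h : BoundedOnPosCompact fun x => f (x ^ (k + m)) - x ^ k * g (x ^ m)) :
    ∃ δ > 0, ∃ M : ℝ, ∀ y : ℝ, |y| < δ → |f (y ^ (k + m)) - y ^ k * g (y ^ m)| ≤ M := by
  obtain ⟨K, hK, -, hpos, B, hB⟩ := h
  obtain ⟨δ, hδ, H⟩ := hK.exists_volume_affine_mem_pos hpos (k + m + 1)
  obtain ⟨M, hM⟩ := exists_abs_coeff_le_of_abs_eval_nat_le (k + m) B
  refine ⟨δ / (k + m + 1), by positivity, M, fun y hy => ?_⟩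
  obtain ⟨x, -, hx⟩ := MeasureTheory.nonempty_of_measure_ne_zero
    (H (fun _ => 1) (fun i => i * y) (fun i hi => ⟨by norm_num, fun x _ => by
      rw [lt_div_iff₀ (by positivity)] at hy
      rw [one_mul, add_sub_cancel_left, abs_mul, Nat.abs_cast]
      have : (i : ℝ) ≤ k + m + 1 := by exact_mod_cast hi.le
      nlinarith [abs_nonneg y]⟩)).ne'
  rw [← coeff_top_pairLinePoly f g k m x y]
  refine hM _ (natDegree_pairLinePoly_le f g k m x y) fun j hj => ?_
  have := eval_pairLinePoly f g k m x y j
  rw [Rat.cast_natCast] at this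
  rw [this]
  exact hB _ (by simpa using hx j (by omega))

theorem exists_bound_mul_abs_pow {f g : ℝ →+ ℝ} {k m : ℕ} (hk : 1 ≤ k)
    (h : BoundedOnPosCompact fun x => f (x ^ (k + m)) - x ^ k * g (x ^ m)) :
    ∃ M : ℝ, ∀ y : ℝ, |f (y ^ (k + m)) - y ^ k * g (y ^ m)| ≤ M * |y| ^ (k + m) := by
  obtain ⟨δ, hδ, M, hM⟩ := exists_bound_near_zero h
  have hM0 : 0 ≤ M := (abs_nonneg _).trans (hM 0 (by simpa using hδ))
  refine ⟨M * (2 / δ) ^ (k + m), fun y => ?_⟩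
  rcases eq_or_ne y 0 with rfl | hy
  · rw [zero_pow (by omega), zero_pow (by omega)]; simp; positivity
  have hy' : 0 < |y| := abs_pos.mpr hy
  -- A rational rescaling puts `q * |y|` between `δ / 2` and `δ`.
  obtain ⟨q, hq1, hq2⟩ := exists_rat_btwn (show δ / 2 / |y| < δ / |y| by gcongr; linarith)
  have hq0 : (0 : ℝ) < q := lt_trans (by positivity) hq1
  have hb := hM (q * y) (by
    rw [abs_mul, abs_of_pos hq0]; exact (lt_div_iff₀ hy').mp hq2)
  have hhom : f ((q * y) ^ (k + m)) - (q * y) ^ k * g ((q * y) ^ m) =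
      (q : ℝ) ^ (k + m) * (f (y ^ (k + m)) - y ^ k * g (y ^ m)) := by
    have e1 := f.map_rat_mul (q ^ (k + m)) (y ^ (k + m))
    have e2 := g.map_rat_mul (q ^ m) (y ^ m)
    push_cast at e1 e2
    rw [mul_pow, mul_pow, mul_pow, e1, e2]; ring
  rw [hhom, abs_mul, abs_of_pos (pow_pos hq0 _)] at hb
  have h1 : 1 ≤ 2 / δ * |y| * q := by
    rw [div_lt_iff₀ hy'] at hq1
    rw [div_mul_eq_mul_div, div_mul_eq_mul_div, le_div_iff₀ hδ]; linarith
  calc |f (y ^ (k + m)) - y ^ k * g (y ^ m)|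
      ≤ (2 / δ * |y| * q) ^ (k + m) * |f (y ^ (k + m)) - y ^ k * g (y ^ m)| :=
        le_mul_of_one_le_left (abs_nonneg _) (one_le_pow₀ h1)
    _ = (2 / δ * |y|) ^ (k + m) * (q ^ (k + m) * |f (y ^ (k + m)) - y ^ k * g (y ^ m)|) := by
        ring
    _ ≤ (2 / δ * |y|) ^ (k + m) * M := by gcongr
    _ = M * (2 / δ) ^ (k + m) * |y| ^ (k + m) := by ring

open Polynomial in
theorem pairLinePoly_eq_zero {f g : ℝ →+ ℝ} (hf : f 1 = 0) (hg : g 1 = 0) {k m : ℕ} (hk : 1 ≤ k)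
    (h : BoundedOnPosCompact fun x => f (x ^ (k + m)) - x ^ k * g (x ^ m)) {x : ℝ} (hx : x ≠ 0) :
    pairLinePoly f g k m 1 x = 0 := by
  obtain ⟨M, hM⟩ := exists_bound_mul_abs_pow hk h
  set P := pairLinePoly f g k m 1 x with hP
  have hreal : ∀ t : ℝ, |P.eval t| ≤ M * |1 + t * x| ^ (k + m) := by
    have hcl : IsClosed {t : ℝ | |P.eval t| ≤ M * |1 + t * x| ^ (k + m)} :=
      isClosed_le (by fun_prop) (by fun_prop)
    have hsub : Set.range ((↑) : ℚ → ℝ) ⊆ {t : ℝ | |P.eval t| ≤ M * |1 + t * x| ^ (k + m)} := by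
      rintro _ ⟨q, rfl⟩
      simp only [Set.mem_ofPred_eq, hP, eval_pairLinePoly]
      exact hM _
    exact fun t => hcl.closure_subset_iff.mpr hsub (Rat.denseRange_cast t)
  obtain ⟨Q, hQ⟩ : (X - C (-x⁻¹)) ^ (k + m) ∣ P := by
    refine X_sub_C_pow_dvd_of_abs_eval_le (M := M * |x| ^ (k + m)) fun t => ?_
    refine (hreal t).trans_eq ?_
    rw [mul_assoc, ← mul_pow, ← abs_mul]
    congr 3
    field_simp
    ring
  have hdeg := natDegree_pairLinePoly_le f g k m 1 x
  have h0 : P.eval 0 = 0 := by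
    have := eval_pairLinePoly f g k m 1 x 0
    simpa [hf, hg] using this
  by_contra hne
  rw [← hP, hQ] at hdeg
  have hQ0 : Q ≠ 0 := by rintro rfl; exact hne (by rw [hQ, mul_zero])
  rw [((monic_X_sub_C _).pow _).natDegree_mul' hQ0, natDegree_pow, natDegree_X_sub_C, mul_one]
    at hdeg
  -- The root of order `k + m` exhausts the degree, so the cofactor is a constant, which the root at
  -- `0` kills.
  obtain ⟨c, rfl⟩ := natDegree_eq_zero.mp (show Q.natDegree = 0 by omega)
  rw [hQ] at h0
  simp [hx] at h0
  exact hQ0 (by rw [h0, map_zero])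

theorem relations_of_boundedOnPosCompact_of_map_one {f g : ℝ →+ ℝ} (hf : f 1 = 0) (hg : g 1 = 0)
    {k m : ℕ} (hk : 1 ≤ k) (hm : 1 ≤ m)
    (h : BoundedOnPosCompact fun x => f (x ^ (k + m)) - x ^ k * g (x ^ m)) (x : ℝ) :
    ((k + m : ℕ) : ℝ) * f x = m * g x ∧ f (x ^ 2) = 2 * x * f x := by
  have key : ∀ y : ℝ, y ≠ 0 → _ := fun y hy =>
    relations_of_pairLinePoly_eq_zero f g hg k m y (pairLinePoly_eq_zero hf hg hk h hy)
  rcases eq_or_ne x 0 with rfl | hx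
  · simp
  refine ⟨(key x hx).1, ?_⟩
  have e1 := (key x hx).1
  have e2 := (key x hx).2
  have e3 := (key (x ^ 2) (pow_ne_zero 2 hx)).1
  rw [Nat.cast_choose_two, Nat.cast_choose_two] at e2
  push_cast at e1 e2 e3
  have hk' : (1 : ℝ) ≤ k := by exact_mod_cast hk
  have hm' : (1 : ℝ) ≤ m := by exact_mod_cast hm
  have hne : ((k : ℝ) + m) * k ≠ 0 := by positivity
  refine mul_left_cancel₀ hne ?_
  -- Eliminate `g (x ^ 2)` and `g x` from the quadratic relation by the linear one at `x ^ 2` and at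
  -- `x`.
  linear_combination 2 * e2 - ((m : ℝ) - 1) * e3 - 2 * k * x * e1

/-- The additive function `x ↦ f x - f 1 * x`. -/
def AddMonoidHom.normalize (f : ℝ →+ ℝ) : ℝ →+ ℝ := f - AddMonoidHom.mulLeft (f 1)

theorem AddMonoidHom.normalize_apply (f : ℝ →+ ℝ) (x : ℝ) : f.normalize x = f x - f 1 * x := rfl

theorem AddMonoidHom.normalize_one (f : ℝ →+ ℝ) : f.normalize 1 = 0 := by
  simp [AddMonoidHom.normalize_apply]

/-- Changing a function by one that is continuous on `(0, ∞)` keeps it bounded. -/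
theorem BoundedOnPosCompact.of_eq_add {φ ψ u : ℝ → ℝ} (h : BoundedOnPosCompact φ)
    (hu : ContinuousOn u (Set.Ioi 0)) (heq : ∀ x > 0, ψ x = φ x + u x) :
    BoundedOnPosCompact ψ := by
  obtain ⟨K, hK, hK0, hpos, B, hB⟩ := h
  obtain ⟨B', hB'⟩ := hK.exists_bound_of_continuousOn (hu.mono hK0)
  refine ⟨K, hK, hK0, hpos, B + B', fun x hx => ?_⟩
  rw [heq x (hK0 hx)]
  exact (abs_add_le _ _).trans (add_le_add (hB x hx) (hB' x hx))

theorem BoundedOnPosCompact.of_eq_mul {φ ψ u : ℝ → ℝ} (h : BoundedOnPosCompact φ)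
    (hu : ContinuousOn u (Set.Ioi 0)) (heq : ∀ x > 0, ψ x = u x * φ x) :
    BoundedOnPosCompact ψ := by
  obtain ⟨K, hK, hK0, hpos, B, hB⟩ := h
  obtain ⟨B', hB'⟩ := hK.exists_bound_of_continuousOn (hu.mono hK0)
  refine ⟨K, hK, hK0, hpos, B' * B, fun x hx => ?_⟩
  rw [heq x (hK0 hx), abs_mul]
  exact mul_le_mul (hB' x hx) (hB x hx) (abs_nonneg _) ((norm_nonneg _).trans (hB' x hx))

theorem relations_of_boundedOnPosCompact {f g : ℝ →+ ℝ} {k m : ℕ} (hk : 1 ≤ k) (hm : 1 ≤ m)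
    (h : BoundedOnPosCompact fun x => f (x ^ (k + m)) - x ^ k * g (x ^ m)) (x : ℝ) :
    ((k + m : ℕ) : ℝ) * f.normalize x = m * g.normalize x ∧
      f.normalize (x ^ 2) = 2 * x * f.normalize x := by
  refine relations_of_boundedOnPosCompact_of_map_one f.normalize_one g.normalize_one hk hm
    (h.of_eq_add (u := fun x => (g 1 - f 1) * x ^ (k + m)) (by fun_prop) fun x _ => ?_) x
  simp only [AddMonoidHom.normalize_apply]
  ring

/-! ### Opposite exponents -/

open MeasureTheory in
/-- For some `a`, a set of positive measure consists of points `x ∈ K` whose reflection `2a - x` in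
`a` lies in `K` together with the harmonic mean of the two. -/
theorem IsCompact.exists_volume_harmonic_mem_pos {K : Set ℝ} (hK : IsCompact K)
    (hK0 : K ⊆ Set.Ioi 0) (hpos : 0 < volume K) :
    ∃ a > 0, 0 < volume {x | x ∈ K ∧ 2 * a - x ∈ K ∧ x * (2 * a - x) / a ∈ K} := by
  obtain ⟨δ, hδ, H⟩ := hK.exists_volume_affine_mem_pos hpos 3
  obtain ⟨R, hR0, hR⟩ := hK.isBounded.exists_pos_norm_le
  -- With `x = (1 + t) * a`, the reflection is `(1 - t) * a` and the harmonic mean `(1 - t ^ 2) *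
  -- a`. All small `t` have slices of positive measure, so by Fubini some `a` does too.
  set W : Set (ℝ × ℝ) :=
    {p | (1 + p.1) * p.2 ∈ K ∧ (1 - p.1) * p.2 ∈ K ∧ (1 - p.1 ^ 2) * p.2 ∈ K} with hW
  have hWc : IsClosed W :=
    (hK.isClosed.preimage (by fun_prop)).inter
      ((hK.isClosed.preimage (by fun_prop)).inter (hK.isClosed.preimage (by fun_prop)))
  have hslice : ∀ t : ℝ, |t| < min (1 / 2) (δ / R) → 0 < volume (Prod.mk t ⁻¹' W) := by
    intro t ht
    obtain ⟨ht1, ht2⟩ := lt_min_iff.mp ht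
    rw [lt_div_iff₀ hR0] at ht2
    have hclose : ∀ s : ℝ, |s| ≤ |t| → 1 / 2 ≤ 1 + s ∧ ∀ x ∈ K, |(1 + s) * x + 0 - x| < δ := by
      intro s hs
      refine ⟨by linarith [neg_abs_le s], fun x hx => ?_⟩
      have h1 : (1 + s) * x + 0 - x = s * x := by ring
      rw [h1, abs_mul]
      exact (mul_le_mul hs (hR x hx) (abs_nonneg _) (abs_nonneg _)).trans_lt ht2
    have hsq : |(-t ^ 2 : ℝ)| ≤ |t| := by
      rw [abs_neg, abs_pow]; nlinarith [abs_nonneg t]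
    refine (H (fun i => if i = 0 then 1 + t else if i = 1 then 1 + -t else 1 + -t ^ 2)
      (fun _ => 0) ?_).trans_le (measure_mono ?_)
    · intro i hi
      interval_cases i
      · simpa using hclose t le_rfl
      · simpa using hclose (-t) (abs_neg t).le
      · simpa using hclose (-t ^ 2) hsq
    · rintro x ⟨-, hx⟩
      have h0 := hx 0 (by norm_num)
      have h1 := hx 1 (by norm_num)
      have h2 := hx 2 (by norm_num)
      simp only [add_zero, ↓reduceIte, one_ne_zero, OfNat.ofNat_ne_zero, OfNat.ofNat_ne_one,
        ← sub_eq_add_neg] at h0 h1 h2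
      exact ⟨h0, h1, h2⟩
  have hex : ∃ a : ℝ, volume ((fun t => (t, a)) ⁻¹' W) ≠ 0 := by
    by_contra! hall
    have hnull : (volume : Measure (ℝ × ℝ)) W = 0 := by
      rw [Measure.volume_eq_prod, Measure.prod_apply_symm hWc.measurableSet]
      simp [hall]
    rw [Measure.volume_eq_prod] at hnull
    have hae := Measure.measure_ae_null_of_prod_null hnull
    have hball : volume (Metric.ball (0 : ℝ) (min (1 / 2) (δ / R))) = 0 := by
      refine measure_mono_null (fun t ht => ?_) (ae_iff.mp hae)
      rw [Metric.mem_ball, Real.dist_eq, sub_zero] at ht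
      exact (hslice t ht).ne'
    exact (Metric.measure_ball_pos volume (0 : ℝ)
      (lt_min (by norm_num) (div_pos hδ hR0))).ne' hball
  obtain ⟨a, ha⟩ := hex
  obtain ⟨t, ht⟩ := nonempty_of_measure_ne_zero ha
  have ha0 : 0 < a := by
    have h1 : 0 < (1 + t) * a := hK0 ht.1
    have h2 : 0 < (1 - t) * a := hK0 ht.2.1
    linarith
  refine ⟨a, ha0, pos_iff_ne_zero.mpr fun h0 => ha ?_⟩
  have hsub : (fun t => (t, a)) ⁻¹' W ⊆ (1 + ·) ⁻¹' ((a * ·) ⁻¹'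
      {x | x ∈ K ∧ 2 * a - x ∈ K ∧ x * (2 * a - x) / a ∈ K}) := by
    rintro t ⟨h1, h2, h3⟩
    refine ⟨?_, ?_, ?_⟩
    · convert h1 using 1; simp only; ring
    · convert h2 using 1; simp only; ring
    · convert h3 using 1; simp only; field_simp; ring
  refine measure_mono_null hsub ?_
  rw [measure_preimage_add, Real.volume_preimage_mul_left ha0.ne', h0, mul_zero]

theorem map_sq_of_boundedOnPosCompact_inv_of_map_one {f g : ℝ →+ ℝ} (hf : f 1 = 0)
    (h : BoundedOnPosCompact fun x => f x - x ^ 2 * g x⁻¹) (x : ℝ) :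
    f (x ^ 2) = 2 * x * f x := by
  obtain ⟨K, hK, hK0, hpos, B, hB⟩ := h
  obtain ⟨a, ha, hapos⟩ := hK.exists_volume_harmonic_mem_pos hK0 hpos
  set L := {x | x ∈ K ∧ 2 * a - x ∈ K ∧ x * (2 * a - x) / a ∈ K} with hL
  have hLc : IsCompact L := hK.inter_right
    ((hK.isClosed.preimage (by fun_prop)).inter (hK.isClosed.preimage (by fun_prop)))
  let f₂ : ℝ →+ ℝ := (AddMonoidHom.mulLeft (4 * a ^ 2)).comp
    (f.comp (AddMonoidHom.mulLeft (2 * a)⁻¹))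
  let g₂ : ℝ →+ ℝ := (AddMonoidHom.mulLeft (4 * a)).comp f - AddMonoidHom.mulLeft (f (2 * a))
  have hf₂ : ∀ x, f₂ x = 4 * a ^ 2 * f ((2 * a)⁻¹ * x) := fun _ => rfl
  have hg₂ : ∀ x, g₂ x = 4 * a * f x - f (2 * a) * x := fun _ => rfl
  have hbdd : BoundedOnPosCompact fun x => f₂ (x ^ (1 + 1)) - x ^ 1 * g₂ (x ^ 1) := by
    refine ⟨L, hLc, fun x hx => hK0 hx.1, hapos, 10 * a ^ 2 * B, ?_⟩
    rintro x ⟨hx, hy, hz⟩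
    have hx0 : 0 < x := hK0 hx
    have hy0 : 0 < 2 * a - x := hK0 hy
    have b1 := hB _ hx
    have b2 := hB _ hy
    have b3 := hB _ hz
    have hgrel : g x⁻¹ + g (2 * a - x)⁻¹ = 2 * g (x * (2 * a - x) / a)⁻¹ := by
      rw [← map_add, two_mul (g _), ← map_add]
      congr 1
      field_simp
      ring
    have hfy : f (2 * a - x) = f (2 * a) - f x := map_sub f _ _
    have hfz : f (x * (2 * a - x) / a) = 2 * f x - 2 * f ((2 * a)⁻¹ * x ^ 2) := by
      rw [two_mul (f x), two_mul (f _), ← map_add, ← map_add, ← map_sub]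
      congr 1
      field_simp
      ring
    have hz2 : 2 * a ^ 2 * (x * (2 * a - x) / a) ^ 2 = 2 * (x * (2 * a - x)) ^ 2 := by
      field_simp
    -- The weights turn the `g` terms into a multiple of `hgrel`; the `f` terms that remain define
    -- `f₂` and `g₂`.
    have hid : f₂ (x ^ (1 + 1)) - x ^ 1 * g₂ (x ^ 1) =
        (2 * a - x) ^ 2 * (f x - x ^ 2 * g x⁻¹) +
        x ^ 2 * (f (2 * a - x) - (2 * a - x) ^ 2 * g (2 * a - x)⁻¹) -
        2 * a ^ 2 * (f (x * (2 * a - x) / a) -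
          (x * (2 * a - x) / a) ^ 2 * g (x * (2 * a - x) / a)⁻¹) := by
      rw [hf₂, hg₂, hfy, hfz, one_add_one_eq_two, pow_one]
      linear_combination (x * (2 * a - x)) ^ 2 * hgrel - g (x * (2 * a - x) / a)⁻¹ * hz2
    have hB0 : 0 ≤ B := (abs_nonneg _).trans b1
    have hyb : (2 * a - x) ^ 2 ≤ 4 * a ^ 2 := by nlinarith
    have hxb : x ^ 2 ≤ 4 * a ^ 2 := by nlinarith
    change |f₂ (x ^ (1 + 1)) - x ^ 1 * g₂ (x ^ 1)| ≤ _
    rw [hid]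
    refine (abs_sub _ _).trans ((add_le_add_left (abs_add_le _ _) _).trans ?_)
    rw [abs_mul, abs_mul, abs_mul, abs_of_nonneg (sq_nonneg (2 * a - x)),
      abs_of_nonneg (sq_nonneg x), abs_of_nonneg (show 0 ≤ 2 * a ^ 2 by positivity)]
    have c1 := mul_le_mul hyb b1 (abs_nonneg _) (by positivity)
    have c2 := mul_le_mul hxb b2 (abs_nonneg _) (by positivity)
    have c3 := mul_le_mul_of_nonneg_left b3 (show 0 ≤ 2 * a ^ 2 by positivity)
    linarith
  have hrel := relations_of_boundedOnPosCompact le_rfl le_rfl hbdd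
  have hg₂n : ∀ x, g₂.normalize x = 4 * a * f x := by
    intro x
    rw [AddMonoidHom.normalize_apply, hg₂, hg₂, hf]; ring
  have e1 := (hrel x).1
  have e2 := (hrel (x ^ 2)).1
  have e3 := (hrel x).2
  rw [hg₂n] at e1 e2
  push_cast at e1 e2
  refine mul_left_cancel₀ (show 4 * a ≠ 0 by positivity) ?_
  linear_combination -e2 + 2 * e3 + 2 * x * e1

theorem map_sq_of_boundedOnPosCompact_inv {f g : ℝ →+ ℝ}
    (h : BoundedOnPosCompact fun x => f x - x ^ 2 * g x⁻¹) (x : ℝ) :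
    f.normalize (x ^ 2) = 2 * x * f.normalize x :=
  map_sq_of_boundedOnPosCompact_inv_of_map_one (g := g) f.normalize_one
    (h.of_eq_add (u := fun x => -(f 1 * x)) (by fun_prop) fun x _ => by
      simp only [AddMonoidHom.normalize_apply]; ring) x

/-! ### From squares to derivations -/

theorem AddMonoidHom.map_mul_of_map_sq {f : ℝ →+ ℝ} (h : ∀ x, f (x ^ 2) = 2 * x * f x) (x y : ℝ) :
    f (x * y) = x * f y + y * f x := by
  have h1 := h (x + y)
  have h2 : (x + y) ^ 2 = x ^ 2 + (x * y + x * y) + y ^ 2 := by ring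
  rw [h2, map_add, map_add, map_add, map_add, h, h] at h1
  linarith

theorem AddMonoidHom.exists_derivation {f : ℝ →+ ℝ} (h : ∀ x, f (x ^ 2) = 2 * x * f x) :
    ∃ D : Derivation ℤ ℝ ℝ, ∀ x, D x = f x :=
  ⟨Derivation.mk' f.toIntLinearMap fun x y => by simpa using f.map_mul_of_map_sq h x y,
    fun _ => rfl⟩

/-! ### From local regularity to boundedness -/

open MeasureTheory in
/-- Boundedness on a compact set of positive measure passes to the image under `x ↦ x ^ j`. -/
theorem BoundedOnPosCompact.of_comp_zpow {φ : ℝ → ℝ} {j : ℤ} (hj : j ≠ 0)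
    (h : BoundedOnPosCompact fun x => φ (x ^ j)) : BoundedOnPosCompact φ := by
  obtain ⟨K, hK, hK0, hpos, B, hB⟩ := h
  have hne : ∀ x ∈ K, x ≠ 0 := fun x hx => (hK0 hx : 0 < x).ne'
  have hcont : ContinuousOn (fun x : ℝ => x ^ j) K := fun x hx =>
    (continuousAt_zpow₀ x j (Or.inl (hne x hx))).continuousWithinAt
  have hinj : Set.InjOn (fun x : ℝ => x ^ j) K := fun x hx y hy hxy =>
    (zpow_left_inj₀ (hK0 hx : 0 < x).le (hK0 hy : 0 < y).le hj).mp hxy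
  refine ⟨(fun x : ℝ => x ^ j) '' K, hK.image_of_continuousOn hcont, ?_, ?_, B, ?_⟩
  · rintro _ ⟨x, hx, rfl⟩
    exact zpow_pos (show 0 < x from hK0 hx) j
  -- The image has measure the integral over `K` of the absolute derivative, which is nowhere zero
  -- there.
  · have hcv := lintegral_image_eq_lintegral_abs_deriv_mul hK.measurableSet
      (fun x hx => (hasDerivAt_zpow j x (Or.inl (hne x hx))).hasDerivWithinAt) hinj (fun _ => 1)
    rw [setLIntegral_one] at hcv
    rw [hcv, setLIntegral_pos_iff (by fun_prop)]
    refine hpos.trans_le (measure_mono fun x hx => ⟨?_, hx⟩)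
    have : (j : ℝ) * x ^ (j - 1) ≠ 0 :=
      mul_ne_zero (by exact_mod_cast hj) (zpow_ne_zero _ (hne x hx))
    simpa only [Function.mem_support, mul_one, ne_eq, ENNReal.ofReal_eq_zero, not_le, abs_pos]
      using this
  · rintro _ ⟨x, hx, rfl⟩
    exact hB x hx

open MeasureTheory in
theorem LocallyRegularOn.exists_bounded {φ : ℝ → ℝ} {U : Set ℝ} (hU : IsOpen U)
    (h : LocallyRegularOn φ U) :
    ∃ D ⊆ U, NullMeasurableSet D volume ∧ 0 < volume D ∧ ∃ C : ℝ, ∀ x ∈ D, |φ x| ≤ C := by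
  rcases h with h | ⟨x, hx, hc⟩ | ⟨D, hDU, hD, hpos, hmeas⟩
  · exact h
  · have hca : ContinuousAt φ x := hc.continuousAt (hU.mem_nhds hx)
    have hev : ∀ᶠ y in nhds x, |φ y| < |φ x| + 1 :=
      hca.abs.eventually_lt continuousAt_const (lt_add_one _)
    obtain ⟨V, hV, hVo, hxV⟩ := mem_nhds_iff.mp (Filter.inter_mem hev (hU.mem_nhds hx))
    exact ⟨V, fun y hy => (hV hy).2, hVo.measurableSet.nullMeasurableSet,
      hVo.measure_pos volume ⟨x, hxV⟩, |φ x| + 1, fun y hy => (hV hy).1.le⟩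
  · have hcover : D = ⋃ N : ℕ, D ∩ φ ⁻¹' Set.Icc (-(N : ℝ)) N := by
      rw [← Set.inter_iUnion, eq_comm, Set.inter_eq_left]
      intro x _
      obtain ⟨N, hN⟩ := exists_nat_ge |φ x|
      exact Set.mem_iUnion.mpr ⟨N, abs_le.mp hN⟩
    obtain ⟨N, hN⟩ : ∃ N : ℕ, volume (D ∩ φ ⁻¹' Set.Icc (-(N : ℝ)) N) ≠ 0 := by
      by_contra! hall
      rw [hcover, measure_iUnion_null hall] at hpos
      exact lt_irrefl _ hpos
    exact ⟨_, Set.inter_subset_left.trans hDU, hmeas _ measurableSet_Icc,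
      pos_iff_ne_zero.mpr hN, N, fun x hx => abs_le.mpr hx.2⟩

open MeasureTheory in
theorem LocallyRegularOn.boundedOnPosCompact {φ : ℝ → ℝ} (h : LocallyRegularOn φ {x : ℝ | x ≠ 0})
    (heven : ∀ x, |φ (-x)| = |φ x|) : BoundedOnPosCompact φ := by
  obtain ⟨D, hD0, hD, hpos, C, hC⟩ := h.exists_bounded isOpen_ne
  have hstep : ∀ E : Set ℝ, E ⊆ Set.Ioi 0 → NullMeasurableSet E volume → 0 < volume E →
      (∀ x ∈ E, |φ x| ≤ C) → BoundedOnPosCompact φ := by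
    intro E hE0 hE hEpos hEC
    obtain ⟨S, hSE, hS, hae⟩ := hE.exists_measurable_subset_ae_eq
    obtain ⟨K, hKS, hK, hKpos⟩ := hS.exists_lt_isCompact (hEpos.trans_eq (measure_congr hae).symm)
    exact ⟨K, hK, hKS.trans (hSE.trans hE0), hKpos, C, fun x hx => hEC x (hSE (hKS hx))⟩
  by_cases hp : volume (D ∩ Set.Ioi 0) = 0
  · refine hstep ((fun x => -x) ⁻¹' (D ∩ Set.Iio 0)) (fun x hx => by simpa using hx.2)
      ((hD.inter measurableSet_Iio.nullMeasurableSet).preimage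
        (Measure.measurePreserving_neg volume).quasiMeasurePreserving) ?_ ?_
    · rw [Measure.measure_preimage_neg, pos_iff_ne_zero]
      intro hn
      have hcover : D ⊆ (D ∩ Set.Ioi 0) ∪ (D ∩ Set.Iio 0) := fun x hx =>
        (lt_or_gt_of_ne (hD0 hx)).elim (fun h => Or.inr ⟨hx, h⟩) (fun h => Or.inl ⟨hx, h⟩)
      exact hpos.ne' (measure_mono_null hcover (measure_union_null hp hn))
    · intro x hx
      rw [← heven]
      exact hC _ hx.1
  · exact hstep _ Set.inter_subset_right (hD.inter measurableSet_Ioi.nullMeasurableSet)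
      (pos_iff_ne_zero.mpr hp) fun x hx => hC x hx.1

theorem abs_pair_neg (n m : ℤ) (f g : ℝ →+ ℝ) (x : ℝ) :
    |f ((-x) ^ n) - (-x) ^ (n - m) * g ((-x) ^ m)| = |f (x ^ n) - x ^ (n - m) * g (x ^ m)| := by
  rcases Int.even_or_odd n with hn | hn <;> rcases Int.even_or_odd m with hm | hm
  · rw [hn.neg_zpow, hm.neg_zpow, (hn.sub hm).neg_zpow]
  · rw [hn.neg_zpow, hm.neg_zpow, (hn.sub_odd hm).neg_zpow, map_neg, neg_mul_neg]
  · rw [hn.neg_zpow, hm.neg_zpow, (hn.sub_even hm).neg_zpow, map_neg, neg_mul, ← neg_sub',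
      abs_neg]
  · rw [hn.neg_zpow, hm.neg_zpow, (hn.sub_odd hm).neg_zpow, map_neg, map_neg, mul_neg, ← neg_sub',
      abs_neg]

/-! ### Reduction of all exponents to the two cases -/

/-- The normalizations of `f` and `g` are derivations in the ratio `m : n`. -/
def DerivationPair (n m : ℤ) (f g : ℝ →+ ℝ) : Prop :=
  (∀ x, f.normalize (x ^ 2) = 2 * x * f.normalize x) ∧
    (∀ x, g.normalize (x ^ 2) = 2 * x * g.normalize x) ∧
    ∀ x, (n : ℝ) * f.normalize x = m * g.normalize x

theorem derivationPair_of_lt {n m : ℕ} (hm : 1 ≤ m) (hlt : m < n) {f g : ℝ →+ ℝ}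
    (h : BoundedOnPosCompact fun x => f (x ^ (n : ℤ)) - x ^ ((n : ℤ) - m) * g (x ^ (m : ℤ))) :
    DerivationPair n m f g := by
  obtain ⟨k, rfl⟩ : ∃ k, n = k + m := ⟨n - m, by omega⟩
  have hrel := relations_of_boundedOnPosCompact (f := f) (g := g) (show 1 ≤ k by omega) hm (by
    have e : ((k + m : ℕ) : ℤ) - m = (k : ℤ) := by push_cast; ring
    simpa only [e, zpow_natCast] using h)
  refine ⟨fun x => (hrel x).2, fun x => ?_, fun x => by exact_mod_cast (hrel x).1⟩
  have hm' : (m : ℝ) ≠ 0 := by exact_mod_cast (show m ≠ 0 by omega)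
  refine mul_left_cancel₀ hm' ?_
  rw [← (hrel (x ^ 2)).1, (hrel x).2]
  linear_combination 2 * x * (hrel x).1

theorem derivationPair_of_nat {n m : ℕ} (hn : 1 ≤ n) (hm : 1 ≤ m) (hne : n ≠ m) {f g : ℝ →+ ℝ}
    (h : BoundedOnPosCompact fun x => f (x ^ (n : ℤ)) - x ^ ((n : ℤ) - m) * g (x ^ (m : ℤ))) :
    DerivationPair n m f g := by
  rcases lt_or_gt_of_ne hne with hlt | hlt
  -- Multiplication by `-x ^ (m - n)` exchanges the roles of `f` and `g`.
  · obtain ⟨h1, h2, h3⟩ := derivationPair_of_lt (f := g) (g := f) hn hlt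
      (h.of_eq_mul (u := fun x => -x ^ ((m : ℤ) - n)) (fun x hx =>
        (continuousAt_zpow₀ x _ (Or.inl (hx : 0 < x).ne')).neg.continuousWithinAt) fun x hx => by
        have : x ^ ((m : ℤ) - n) * x ^ ((n : ℤ) - m) = 1 := by
          rw [← zpow_add₀ hx.ne']; simp
        linear_combination -g (x ^ (m : ℤ)) * this)
    exact ⟨h2, h1, fun x => (h3 x).symm⟩
  · exact derivationPair_of_lt hm hlt h

/-- Inversion exchanges `f` and `g`, so both normalizations `F`, `G` are derivations. Then `x ^ 2 *
G x⁻¹ = -G x`, so `F + G` is bounded on a set of positive measure; the equal-sign case for the pair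
`(0, F + G)` forces it to vanish. -/
theorem derivationPair_of_inv {f g : ℝ →+ ℝ}
    (h : BoundedOnPosCompact fun x => f x - x ^ 2 * g x⁻¹) (n : ℤ) :
    DerivationPair n (-n) f g := by
  have hF := map_sq_of_boundedOnPosCompact_inv h
  have hinv : BoundedOnPosCompact fun x => g x - x ^ 2 * f x⁻¹ := by
    have h' : BoundedOnPosCompact fun x => f x⁻¹ - x⁻¹ ^ 2 * g x :=
      BoundedOnPosCompact.of_comp_zpow (j := -1) (by norm_num) (by simpa using h)
    refine h'.of_eq_mul (u := fun x => -x ^ 2) (by fun_prop) fun x hx => ?_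
    field_simp
    ring
  have hG := map_sq_of_boundedOnPosCompact_inv hinv
  refine ⟨hF, hG, fun x => ?_⟩
  have hsum : BoundedOnPosCompact fun x =>
      (0 : ℝ →+ ℝ) (x ^ (1 + 1)) - x ^ 1 * (f.normalize + g.normalize) (x ^ 1) := by
    have h' : BoundedOnPosCompact fun x => f.normalize x - x ^ 2 * g.normalize x⁻¹ :=
      h.of_eq_add (u := fun x => g 1 * x - f 1 * x) (by fun_prop) fun x hx => by
        simp only [AddMonoidHom.normalize_apply]
        field_simp
        ring
    refine h'.of_eq_mul (u := fun x => -x) (by fun_prop) fun x hx => ?_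
    have hx0 : x ≠ 0 := hx.ne'
    have hd := g.normalize.map_mul_of_map_sq hG x x⁻¹
    rw [mul_inv_cancel₀ hx0, g.normalize_one] at hd
    have hd' : x ^ 2 * g.normalize x⁻¹ = - g.normalize x := by
      have e : x ^ 2 * g.normalize x⁻¹ = x * (x * g.normalize x⁻¹) := by ring
      have e' : x * (x⁻¹ * g.normalize x) = g.normalize x := mul_inv_cancel_left₀ hx0 _
      linear_combination e - x * hd - e'
    simp only [AddMonoidHom.zero_apply, AddMonoidHom.add_apply, pow_one]
    rw [hd']
    ring
  have hrel := (relations_of_boundedOnPosCompact le_rfl le_rfl hsum x).1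
  simp only [AddMonoidHom.normalize_apply (f.normalize + g.normalize),
    AddMonoidHom.normalize_apply 0, AddMonoidHom.zero_apply, AddMonoidHom.add_apply,
    AddMonoidHom.normalize_one] at hrel
  push_cast at hrel ⊢
  linear_combination -(n : ℝ) * hrel

theorem derivationPair_of_boundedOnPosCompact {n m : ℤ} (hn : n ≠ 0) (hm : m ≠ 0) (hnm : n ≠ m)
    (hsign : n = -m ∨ n.sign = m.sign) {f g : ℝ →+ ℝ}
    (h : BoundedOnPosCompact fun x => f (x ^ n) - x ^ (n - m) * g (x ^ m)) :
    DerivationPair n m f g := by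
  rcases hsign with hopp | hsign
  · obtain rfl : m = -n := by omega
    refine derivationPair_of_inv (BoundedOnPosCompact.of_comp_zpow hn ?_) n
    have e : ∀ x : ℝ, x ^ (n - -n) = (x ^ n) ^ 2 := fun x => by
      rw [← zpow_natCast, ← zpow_mul]; congr 1; push_cast; ring
    simpa only [e, zpow_neg] using h
  · rcases lt_or_gt_of_ne hn with hneg | hpos
    · have hmneg : m < 0 := by
        rwa [Int.sign_eq_neg_one_of_neg hneg, eq_comm, Int.sign_eq_neg_one_iff_neg] at hsign
      obtain ⟨n', rfl⟩ : ∃ n' : ℕ, n = -n' := ⟨n.natAbs, by omega⟩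
      obtain ⟨m', rfl⟩ : ∃ m' : ℕ, m = -m' := ⟨m.natAbs, by omega⟩
      obtain ⟨h1, h2, h3⟩ := derivationPair_of_nat (n := n') (m := m') (f := f) (g := g)
        (by omega) (by omega) (by omega)
        (BoundedOnPosCompact.of_comp_zpow (j := -1) (by norm_num) (by
          have e : -(n' : ℤ) - -m' = -((n' : ℤ) - m') := by ring
          simpa only [e, zpow_neg, zpow_one, inv_zpow] using h))
      refine ⟨h1, h2, fun x => ?_⟩
      push_cast
      have := h3 x
      push_cast at this
      linarith
    · have hmpos : 0 < m := by
        rwa [Int.sign_eq_one_of_pos hpos, eq_comm, Int.sign_eq_one_iff_pos] at hsign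
      lift n to ℕ using hpos.le
      lift m to ℕ using hmpos.le
      exact derivationPair_of_nat (by omega) (by omega) (by omega) h

theorem mainTheorem8 (n m : ℤ) (hn : n ≠ 0) (hm : m ≠ 0) (hnm : n ≠ m)
    (hsign : n = -m ∨ n.sign = m.sign) (f g : ℝ →+ ℝ)
    (hreg : LocallyRegularOn (fun x : ℝ => f (x ^ n) - x ^ (n - m) * g (x ^ m)) {x : ℝ | x ≠ 0}) :
    (∃ F : Derivation ℤ ℝ ℝ, ∀ x : ℝ, F x = f x - f 1 * x) ∧
    (∃ G : Derivation ℤ ℝ ℝ, ∀ x : ℝ, G x = g x - g 1 * x) ∧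
    (∀ x : ℝ, (n : ℝ) * (f x - f 1 * x) = (m : ℝ) * (g x - g 1 * x)) := by
  obtain ⟨hF, hG, hFG⟩ := derivationPair_of_boundedOnPosCompact hn hm hnm hsign
    (hreg.boundedOnPosCompact (abs_pair_neg n m f g))
  exact ⟨AddMonoidHom.exists_derivation hF, AddMonoidHom.exists_derivation hG, hFG⟩
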